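/- **Diagram algebras.** Let $z$ be an indeterminate. For $r\ge 1$ let $\mathcal A_r(z)$ be the partition algebra over $\mathbb Z[z]$: the free $\mathbb Z[z]$-module on the set partitions (diagrams) of $\{1,\dots,r,1',\dots,r'\}$, with product $\rho_1\rho_2=z^{\ell}\,\rho_1\circ\rho_2$. Here $\rho_1\circ\rho_2$ is obtained by placing $\rho_1$ above $\rho_2$, identifying the bottom row of $\rho_1$ with the top row of $\rho_2$ and deleting the components which lie in the middle row only, and $\ell$ is the number of components deleted. In $\mathcal A_r(z)$ let * $s_i$ ($1\le i<r$) be the diagram with blocks $\{i,(i+1)'\}$, $\{i+1,i'\}$ and $\{a,a'\}$ for $a\ne i,i+1$; * $p_i$ ($1\le i\le r$) be the diagram with blocks $\{i\}$, $\{i'\}$ and $\{a,a'\}$ for $a\neq i$; * $p_{i+\frac12}$ ($1\le i<r$) be the diagram with blocks $\{i,i+1,i',(i+1)'\}$ and $\{a,a'\}$ for $a\ne i,i+1$. **Recursion.** Define $L_0=0$, $L_1=p_1$, $\sigma_1=1$, $\sigma_2=s_1$, $L_{\frac12}=0$, $\sigma_{\frac12}=\sigma_{1+\frac12}=1$ and,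 for $i\ge 1$, $$L_{i+1}=-s_iL_ip_{i+\frac12}-p_{i+\frac12}L_is_i+p_{i+\frac12}L_ip_{i+1}p_{i+\frac12}+s_iL_is_i+\sigma_{i+1},$$ $$L_{i+\frac12}=-L_ip_{i+\frac12}-p_{i+\frac12}L_i+p_{i+\frac12}L_ip_ip_{i+\frac12}+s_iL_{i-\frac12}s_i+\sigma_{i+\frac12},$$ where, for $i\ge 2$, $$\begin{aligned}\sigma_{i+1}={}&s_{i-1}s_i\sigma_is_is_{i-1}+s_ip_{i-\frac12}L_{i-1}s_ip_{i-\frac12}s_i+p_{i-\frac12}L_{i-1}s_ip_{i-\frac12}\\&-s_ip_{i-\frac12}L_{i-1}s_{i-1}p_{i+\frac12}p_ip_{i-\frac12}-p_{i-\frac12}p_ip_{i+\frac12}s_{i-1}L_{i-1}p_{i-\frac12}s_i,\end{aligned}$$ $$\begin{aligned}\sigma_{i+\frac12}={}&s_{i-1}s_i\sigma_{i-\frac12}s_is_{i-1}+p_{i-\frac12}L_{i-1}s_ip_{i-\frac12}s_i+s_ip_{i-\frac12}L_{i-1}s_ip_{i-\frac12}\\&-p_{i-\frac12}L_{i-1}s_{i-1}p_{i+\frac12}p_ip_{i-\frac12}-s_ip_{i-\frac12}p_ip_{i+\frac12}s_{i-1}L_{i-1}p_{i-\frac12}s_i.\end{aligned}$$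 For $k\ge1$ these formulas give $\sigma_{k+\frac12},\sigma_{k+1}\in\mathcal A_{k+1}(z)$ and $L_{k-\frac12},L_k\in\mathcal A_k(z)$. **Tensor space.** Let $V$ be a complex vector space with basis $v_1,\dots,v_n$, and let $A_r(n)=\mathcal A_r(z)\otimes_{\mathbb Z[z]}\mathbb C$, where $z$ acts on $\mathbb C$ as $n$. The algebra $A_r(n)$, and through it $\mathcal A_r(z)$, acts on $V^{\otimes r}$: a diagram $\rho$ sends $v_{i_1}\otimes\cdots\otimes v_{i_r}$ to the sum of all $v_{i'_1}\otimes\cdots\otimes v_{i'_r}$ such that labelling the top vertices $1,\dots,r$ by $i'_1,\dots,i'_r$ and the bottom vertices $1',\dots,r'$ by $i_1,\dots,i_r$ gives equal labels to vertices in the same block. For $1\le i,j\le n$ let $s_{i,j}$ be the transposition in $\mathfrak S_n$ which interchanges $i$ and $j$ (the identity if $i=j$), acting on $V$ by permuting the basis. **Statement.** Let $k\ge 1$. For all $1\le i_1,\dots,i_{k+1}\le n$, $$\sigma_{k+\frac12}(v_{i_1}\otimes\cdots\otimes v_{i_{k+1}})=s_{i_k,i_{k+1}}^{\otimes (k-1)}(v_{i_1}\otimes\cdots\otimes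 v_{i_{k-1}})\otimes v_{i_k}\otimes v_{i_{k+1}},$$ $$\sigma_{k+1}(v_{i_1}\otimes\cdots\otimes v_{i_{k+1}})=s_{i_k,i_{k+1}}^{\otimes (k+1)}(v_{i_1}\otimes\cdots\otimes v_{i_{k+1}}),$$ and, for all $1\le i_1,\dots,i_k\le n$, $$L_{k-\frac12}(v_{i_1}\otimes\cdots\otimes v_{i_k})=n\,v_{i_1}\otimes\cdots\otimes v_{i_k}-\sum_{j=1}^n s_{i_k,j}^{\otimes(k-1)}(v_{i_1}\otimes\cdots\otimes v_{i_{k-1}})\otimes v_{i_k},$$ $$L_k(v_{i_1}\otimes\cdots\otimes v_{i_k})=\sum_{j=1}^n s_{i_k,j}^{\otimes(k-1)}(v_{i_1}\otimes\cdots\otimes v_{i_{k-1}})\otimes v_j.$$ -/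

import Mathlib

open scoped TensorProduct

/-- A partition diagram on `r` strands: a set partition, given as an equivalence relation, of
`{1, …, r, 1', …, r'}`. The vertex `j` of the top row is `Sum.inl (j - 1)`, the vertex `j'` of the
bottom row is `Sum.inr (j - 1)`. -/
abbrev PartitionDiagram (r : ℕ) : Type := Setoid (Fin r ⊕ Fin r)

namespace PartitionDiagram

variable {r : ℕ}

/-- The rows of `d₁` inside the three rows (top, middle, bottom) of `d₁` placed above `d₂`. -/
def upper : Fin r ⊕ Fin r → Fin r ⊕ (Fin r ⊕ Fin r) :=
  Sum.elim Sum.inl (fun a => Sum.inr (Sum.inl a))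

/-- The rows of `d₂` inside the three rows of `d₁` placed above `d₂`. -/
def lower : Fin r ⊕ Fin r → Fin r ⊕ (Fin r ⊕ Fin r) := Sum.inr

/-- The top and the bottom row inside the three rows of `d₁` placed above `d₂`. -/
def outer : Fin r ⊕ Fin r → Fin r ⊕ (Fin r ⊕ Fin r) :=
  Sum.elim Sum.inl (fun a => Sum.inr (Sum.inr a))

/-- The partition into connected components of the three-row diagram obtained by placing `d₁`
above `d₂` and identifying the bottom row of `d₁` with the top row of `d₂`. -/
@[reducible] def stack (d₁ d₂ : PartitionDiagram r) : Setoid (Fin r ⊕ (Fin r ⊕ Fin r)) :=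
  Relation.EqvGen.setoid fun x y =>
    (∃ a b, d₁ a b ∧ upper a = x ∧ upper b = y) ∨ (∃ a b, d₂ a b ∧ lower a = x ∧ lower b = y)

/-- The composition `d₁ ∘ d₂`. -/
@[reducible] def comp (d₁ d₂ : PartitionDiagram r) : PartitionDiagram r :=
  (stack d₁ d₂).comap outer

/-- The number of components of the three-row diagram that lie in the middle row only. -/
noncomputable def loops (d₁ d₂ : PartitionDiagram r) : ℕ :=
  Nat.card {c : Quotient (stack d₁ d₂) // ∀ x, (Quotient.mk _ (outer x)) ≠ c}

/-- The diagram of a permutation, with blocks `{j, π(j)'}`. -/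
@[reducible] def ofPerm (π : Equiv.Perm (Fin r)) : PartitionDiagram r := Setoid.ker (Sum.elim π id)

/-- The diagram with blocks `{j}`, `{j'}`, and `{a, a'}` for `a ≠ j`. -/
@[reducible] def cut (j : Fin r) : PartitionDiagram r :=
  Setoid.ker (Sum.elim Sum.inl (fun a => if a = j then Sum.inr a else Sum.inl a) :
    Fin r ⊕ Fin r → Fin r ⊕ Fin r)

/-- The diagram with blocks `{j, l, j', l'}` and `{a, a'}` for `a ≠ j, l`. -/
@[reducible] def join (j l : Fin r) : PartitionDiagram r :=
  Setoid.ker (Sum.elim (fun a => if a = l then j else a) (fun a => if a = l then j else a))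

/-- The matrix entry of `d` at a colouring `a` of the top row and a colouring `b` of the bottom
row: `1` if the colours are constant on the blocks of `d`, and `0` otherwise. -/
noncomputable def entry {C : Type*} (d : PartitionDiagram r) (a b : Fin r → C) : ℕ :=
  open Classical in if ∀ x y, d x y → Sum.elim a b x = Sum.elim a b y then 1 else 0

theorem entry_pos {C : Type*} {d : PartitionDiagram r} {a b : Fin r → C}
    (h : ∀ x y, d x y → Sum.elim a b x = Sum.elim a b y) : d.entry a b = 1 := if_pos h

theorem entry_neg {C : Type*} {d : PartitionDiagram r} {a b : Fin r → C}
    (h : ¬ ∀ x y, d x y → Sum.elim a b x = Sum.elim a b y) : d.entry a b = 0 := if_neg h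

theorem stack_compat {C : Type*} {d₁ d₂ : PartitionDiagram r} {a b m : Fin r → C} :
    (∀ x y, stack d₁ d₂ x y → Sum.elim a (Sum.elim m b) x = Sum.elim a (Sum.elim m b) y) ↔
      (∀ x y, d₁ x y → Sum.elim a m x = Sum.elim a m y) ∧
      (∀ x y, d₂ x y → Sum.elim m b x = Sum.elim m b y) := by
  have hu : ∀ x, Sum.elim a (Sum.elim m b) (upper x) = Sum.elim a m x := by
    rintro (x | x) <;> rfl
  have hl : ∀ x, Sum.elim a (Sum.elim m b) (lower x) = Sum.elim m b x := fun x => rfl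
  constructor
  · intro h
    refine ⟨fun x y hxy => ?_, fun x y hxy => ?_⟩
    · rw [← hu, ← hu]
      exact h _ _ (Relation.EqvGen.rel _ _ (Or.inl ⟨x, y, hxy, rfl, rfl⟩))
    · rw [← hl, ← hl]
      exact h _ _ (Relation.EqvGen.rel _ _ (Or.inr ⟨x, y, hxy, rfl, rfl⟩))
  · rintro ⟨h1, h2⟩ x y hxy
    have : stack d₁ d₂ ≤ Setoid.ker (Sum.elim a (Sum.elim m b)) := by
      refine Setoid.eqvGen_le ?_
      rintro x y (⟨p, q, hpq, rfl, rfl⟩ | ⟨p, q, hpq, rfl, rfl⟩)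
      · change Sum.elim a (Sum.elim m b) (upper p) = Sum.elim a (Sum.elim m b) (upper q)
        rw [hu, hu]; exact h1 _ _ hpq
      · exact h2 _ _ hpq
    exact this hxy

open Classical in
theorem card_compat {C : Type*} [Fintype C] (d₁ d₂ : PartitionDiagram r) (a b : Fin r → C)
    (h : ∀ x y, comp d₁ d₂ x y → Sum.elim a b x = Sum.elim a b y) :
    Nat.card {m : Fin r → C // ∀ x y, stack d₁ d₂ x y →
      Sum.elim a (Sum.elim m b) x = Sum.elim a (Sum.elim m b) y} =
      Fintype.card C ^ loops d₁ d₂ := by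
  let I := {c : Quotient (stack d₁ d₂) // ∀ x, (Quotient.mk _ (outer x)) ≠ c}
  have hcard : Nat.card (I → C) = Fintype.card C ^ loops d₁ d₂ := by
    rw [Nat.card_fun, Nat.card_eq_fintype_card (α := C)]; rfl
  rw [← hcard]
  have ho : ∀ (m : Fin r → C) x, Sum.elim a (Sum.elim m b) (outer x) = Sum.elim a b x := by
    rintro m (x | x) <;> rfl
  let F : Quotient (stack d₁ d₂) → (I → C) → C := fun c g =>
    if hc : ∃ x, Quotient.mk _ (outer x) = c then Sum.elim a b hc.choose
    else g ⟨c, fun x hx => hc ⟨x, hx⟩⟩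
  have hFo : ∀ x g, F (Quotient.mk _ (outer x)) g = Sum.elim a b x := by
    intro x g
    have hc : ∃ x', Quotient.mk (stack d₁ d₂) (outer x') = Quotient.mk _ (outer x) := ⟨x, rfl⟩
    simp only [F, dif_pos hc]
    have hq : stack d₁ d₂ (outer hc.choose) (outer x) := Quotient.exact hc.choose_spec
    exact h _ _ hq
  have hFi : ∀ (c : I) g, F c.1 g = g c := by
    intro c g
    have hc : ¬ ∃ x', Quotient.mk (stack d₁ d₂) (outer x') = c.1 := fun ⟨x, hx⟩ => c.2 x hx
    exact dif_neg hc
  have hFm : ∀ g x, Sum.elim a (Sum.elim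
      (fun j => F (Quotient.mk _ (Sum.inr (Sum.inl j))) g) b) x = F (Quotient.mk _ x) g := by
    rintro g (x | x | x)
    · exact (hFo (Sum.inl x) g).symm
    · rfl
    · exact (hFo (Sum.inr x) g).symm
  refine Nat.card_congr
    { toFun := fun m c => Quotient.lift (Sum.elim a (Sum.elim m.1 b)) m.2 c.1
      invFun := fun g => ⟨fun j => F (Quotient.mk _ (Sum.inr (Sum.inl j))) g, ?_⟩
      left_inv := ?_
      right_inv := ?_ }
  · intro x y hxy
    rw [hFm, hFm, Quotient.sound hxy]
  · rintro ⟨m, hm⟩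
    apply Subtype.ext
    funext j
    let g : I → C := fun c => Quotient.lift (Sum.elim a (Sum.elim m b)) hm c.1
    change F (Quotient.mk _ (Sum.inr (Sum.inl j))) g = m j
    by_cases hc : ∃ x, Quotient.mk (stack d₁ d₂) (outer x) = Quotient.mk _ (Sum.inr (Sum.inl j))
    · obtain ⟨x, hx⟩ := hc
      have hq : stack d₁ d₂ (outer x) (Sum.inr (Sum.inl j)) := Quotient.exact hx
      have hv : Sum.elim a b x = m j := (ho m x).symm.trans (hm _ _ hq)
      rw [← hx, ← hv]
      exact hFo x _
    · simp only [F, dif_neg hc]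
      rfl
  · intro g
    funext c
    obtain ⟨c, hc⟩ := c
    induction c using Quotient.ind with
    | _ x =>
      change Sum.elim a (Sum.elim (fun j => F (Quotient.mk _ (Sum.inr (Sum.inl j))) g) b) x = _
      rw [hFm]
      exact hFi ⟨_, hc⟩ g

theorem sum_entry {C : Type*} [Fintype C] (d₁ d₂ : PartitionDiagram r) (a b : Fin r → C) :
    ∑ m : Fin r → C, d₁.entry a m * d₂.entry m b =
      Fintype.card C ^ loops d₁ d₂ * (comp d₁ d₂).entry a b := by
  classical
  have h1 : ∀ m : Fin r → C, d₁.entry a m * d₂.entry m b =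
      if ∀ x y, stack d₁ d₂ x y →
        Sum.elim a (Sum.elim m b) x = Sum.elim a (Sum.elim m b) y then 1 else 0 := by
    intro m
    by_cases h : ∀ x y, stack d₁ d₂ x y →
        Sum.elim a (Sum.elim m b) x = Sum.elim a (Sum.elim m b) y
    · rw [if_pos h]
      obtain ⟨h1, h2⟩ := stack_compat.1 h
      rw [entry_pos h1, entry_pos h2]
    · rw [if_neg h]
      rw [stack_compat, not_and_or] at h
      rcases h with h | h
      · rw [entry_neg h, zero_mul]
      · rw [entry_neg h, mul_zero]
  simp_rw [h1]
  rw [Finset.sum_boole, Nat.cast_id, ← Fintype.card_subtype, ← Nat.card_eq_fintype_card]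
  by_cases h : ∀ x y, comp d₁ d₂ x y → Sum.elim a b x = Sum.elim a b y
  · rw [card_compat d₁ d₂ a b h, entry_pos h, mul_one]
  · rw [entry_neg h, mul_zero]
    have ho : ∀ (m : Fin r → C) x, Sum.elim a (Sum.elim m b) (outer x) = Sum.elim a b x := by
      rintro m (x | x) <;> rfl
    refine @Nat.card_of_isEmpty _ ⟨fun m => h fun x y hxy => ?_⟩
    rw [← ho m.1, ← ho m.1]
    exact m.2 _ _ hxy

theorem entry_const {C : Type*} (d : PartitionDiagram r) (c : C) :
    d.entry (fun _ => c) (fun _ => c) = 1 :=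
  entry_pos (by rintro (x | x) (y | y) _ <;> rfl)

/-- A power of two and a diagram are determined by the two-coloured matrix. -/
theorem eq_of_entry {p q : ℕ} {d d' : PartitionDiagram r}
    (h : ∀ a b : Fin r → Bool, 2 ^ p * d.entry a b = 2 ^ q * d'.entry a b) : p = q ∧ d = d' := by
  classical
  have hpq : p = q := by
    have := h (fun _ => true) (fun _ => true)
    rw [entry_const, entry_const, mul_one, mul_one] at this
    exact Nat.pow_right_injective le_rfl this
  subst hpq
  have h' : ∀ a b : Fin r → Bool, d.entry a b = d'.entry a b := fun a b =>
    Nat.eq_of_mul_eq_mul_left (by positivity) (h a b)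
  refine ⟨rfl, ?_⟩
  have key : ∀ d d' : PartitionDiagram r,
      (∀ a b : Fin r → Bool, d.entry a b = d'.entry a b) → ∀ x y, d x y → d' x y := by
    intro d d' h x y hxy
    let f : Fin r ⊕ Fin r → Bool := fun z => decide (d' x z)
    have hf : Sum.elim (fun a => f (Sum.inl a)) (fun a => f (Sum.inr a)) = f := by
      funext z; rcases z with z | z <;> rfl
    have h1 : d'.entry (fun a => f (Sum.inl a)) (fun a => f (Sum.inr a)) = 1 := by
      refine entry_pos ?_
      rw [hf]
      intro u v huv
      simp only [f, decide_eq_decide]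
      exact ⟨fun hu => d'.trans' hu huv, fun hv => d'.trans' hv (d'.symm' huv)⟩
    rw [← h] at h1
    by_contra hcon
    have h2 : ¬ ∀ u v, d u v → f u = f v := by
      intro hall
      have := hall x y hxy
      simp only [f, decide_eq_decide] at this
      exact hcon (this.1 (d'.refl' x))
    rw [← hf] at h2
    rw [entry_neg h2] at h1
    exact absurd h1 (by norm_num)
  ext x y
  exact ⟨key d d' h' x y, key d' d (fun a b => (h' a b).symm) x y⟩

theorem comp_assoc_aux (d₁ d₂ d₃ : PartitionDiagram r) :
    loops d₁ d₂ + loops (comp d₁ d₂) d₃ = loops d₂ d₃ + loops d₁ (comp d₂ d₃) ∧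
      comp (comp d₁ d₂) d₃ = comp d₁ (comp d₂ d₃) := by
  refine eq_of_entry fun a b => ?_
  have hl : ∑ m' : Fin r → Bool, (∑ m : Fin r → Bool, d₁.entry a m * d₂.entry m m') * d₃.entry m' b =
      2 ^ (loops d₁ d₂ + loops (comp d₁ d₂) d₃) * (comp (comp d₁ d₂) d₃).entry a b := by
    simp_rw [sum_entry, mul_assoc, ← Finset.mul_sum, sum_entry, Fintype.card_bool, pow_add, mul_assoc]
  have hr : ∑ m : Fin r → Bool, d₁.entry a m * (∑ m' : Fin r → Bool, d₂.entry m m' * d₃.entry m' b) =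
      2 ^ (loops d₂ d₃ + loops d₁ (comp d₂ d₃)) * (comp d₁ (comp d₂ d₃)).entry a b := by
    simp_rw [sum_entry, mul_left_comm _ (Fintype.card Bool ^ _), ← Finset.mul_sum, sum_entry,
      Fintype.card_bool, pow_add, mul_assoc]
  rw [← hl, ← hr]
  simp_rw [Finset.sum_mul, Finset.mul_sum, mul_assoc]
  exact Finset.sum_comm

theorem entry_ofPerm {C : Type*} [DecidableEq C] (π : Equiv.Perm (Fin r)) (a b : Fin r → C) :
    (ofPerm π).entry a b = if a = b ∘ π then 1 else 0 := by
  have key : (∀ x y, ofPerm π x y → Sum.elim a b x = Sum.elim a b y) ↔ a = b ∘ π := by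
    constructor
    · intro h
      funext j
      exact h (Sum.inl j) (Sum.inr (π j)) rfl
    · rintro rfl x y hxy
      have h1 : ∀ z, Sum.elim (b ∘ π) b z = b (Sum.elim π id z) := by rintro (z | z) <;> rfl
      rw [h1, h1]
      exact congrArg b hxy
  by_cases h : a = b ∘ π
  · rw [if_pos h, entry_pos (key.2 h)]
  · rw [if_neg h, entry_neg (fun h' => h (key.1 h'))]

theorem one_comp_aux (d : PartitionDiagram r) : loops (ofPerm 1) d = 0 ∧ comp (ofPerm 1) d = d := by
  refine eq_of_entry fun a b => ?_
  have := sum_entry (ofPerm 1) d a b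
  rw [Fintype.card_bool] at this
  rw [← this, pow_zero, one_mul]
  simp [entry_ofPerm]

theorem comp_one_aux (d : PartitionDiagram r) : loops d (ofPerm 1) = 0 ∧ comp d (ofPerm 1) = d := by
  refine eq_of_entry fun a b => ?_
  have := sum_entry d (ofPerm 1) a b
  rw [Fintype.card_bool] at this
  rw [← this, pow_zero, one_mul]
  simp [entry_ofPerm]

end PartitionDiagram

/-- The partition algebra over `R` with parameter `δ`: the free `R`-module on the partition
diagrams on `r` strands, with the product `d₁ d₂ = δ ^ loops d₁ d₂ • (d₁ ∘ d₂)`. -/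
def PartitionAlgebra (R : Type*) [CommRing R] (_δ : R) (r : ℕ) : Type _ := PartitionDiagram r →₀ R

namespace PartitionAlgebra

open PartitionDiagram

section Algebra

variable {R : Type*} [CommRing R] {δ : R} {r : ℕ}

noncomputable instance : AddCommGroup (PartitionAlgebra R δ r) :=
  inferInstanceAs (AddCommGroup (PartitionDiagram r →₀ R))

noncomputable instance : Module R (PartitionAlgebra R δ r) :=
  inferInstanceAs (Module R (PartitionDiagram r →₀ R))

/-- The diagrams form a basis of the partition algebra. -/
noncomputable def diagramBasis (R : Type*) [CommRing R] (δ : R) (r : ℕ) :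
    Module.Basis (PartitionDiagram r) R (PartitionAlgebra R δ r) :=
  Module.Basis.ofRepr (LinearEquiv.refl R (PartitionDiagram r →₀ R))

/-- The basis element of the partition algebra given by a diagram. -/
noncomputable def diag (d : PartitionDiagram r) : PartitionAlgebra R δ r := diagramBasis R δ r d

theorem induction_diag {P : PartitionAlgebra R δ r → Prop} (x : PartitionAlgebra R δ r)
    (hd : ∀ d, P (diag d)) (h0 : P 0) (ha : ∀ x y, P x → P y → P (x + y))
    (hs : ∀ (c : R) x, P x → P (c • x)) : P x := by
  refine Submodule.span_induction (p := fun x _ => P x) ?_ h0 (fun x y _ _ => ha x y)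
    (fun c x _ => hs c x) ((diagramBasis R δ r).mem_span x)
  rintro _ ⟨d, rfl⟩
  exact hd d

/-- The bilinear product of the partition algebra. -/
noncomputable def mulLin :
    PartitionAlgebra R δ r →ₗ[R] PartitionAlgebra R δ r →ₗ[R] PartitionAlgebra R δ r :=
  (diagramBasis R δ r).constr R fun d₁ => (diagramBasis R δ r).constr R fun d₂ =>
    δ ^ loops d₁ d₂ • diag (comp d₁ d₂)

theorem mulLin_diag (d₁ d₂ : PartitionDiagram r) :
    mulLin (diag d₁ : PartitionAlgebra R δ r) (diag d₂) = δ ^ loops d₁ d₂ • diag (comp d₁ d₂) := by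
  simp only [mulLin, diag, Module.Basis.constr_basis]

theorem mulLin_assoc (x y z : PartitionAlgebra R δ r) :
    mulLin (mulLin x y) z = mulLin x (mulLin y z) := by
  induction x using induction_diag with
  | h0 => simp
  | ha x x' h h' => simp [h, h']
  | hs c x h => simp [h]
  | hd d₁ =>
    induction y using induction_diag with
    | h0 => simp
    | ha x x' h h' => simp [h, h']
    | hs c x h => simp [h]
    | hd d₂ =>
      induction z using induction_diag with
      | h0 => simp
      | ha x x' h h' => simp [h, h']
      | hs c x h => simp [h]
      | hd d₃ =>
        obtain ⟨h1, h2⟩ := comp_assoc_aux d₁ d₂ d₃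
        simp only [mulLin_diag, map_smul, LinearMap.smul_apply, smul_smul, ← pow_add, h1, h2]

theorem one_mulLin (x : PartitionAlgebra R δ r) : mulLin (diag (ofPerm 1)) x = x := by
  induction x using induction_diag with
  | h0 => simp
  | ha x x' h h' => simp [h, h']
  | hs c x h => simp [h]
  | hd d =>
    obtain ⟨h1, h2⟩ := one_comp_aux d
    rw [mulLin_diag, h1, h2, pow_zero, one_smul]

theorem mulLin_one (x : PartitionAlgebra R δ r) : mulLin x (diag (ofPerm 1)) = x := by
  induction x using induction_diag with
  | h0 => simp
  | ha x x' h h' => simp [h, h']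
  | hs c x h => simp [h]
  | hd d =>
    obtain ⟨h1, h2⟩ := comp_one_aux d
    rw [mulLin_diag, h1, h2, pow_zero, one_smul]

noncomputable instance : Ring (PartitionAlgebra R δ r) :=
  { (inferInstance : AddCommGroup (PartitionAlgebra R δ r)) with
    mul := fun x y => mulLin x y
    one := diag (ofPerm 1)
    mul_assoc := mulLin_assoc
    one_mul := one_mulLin
    mul_one := mulLin_one
    left_distrib := fun x y z => map_add (mulLin x) y z
    right_distrib := fun x y z => LinearMap.map_add₂ mulLin x y z
    zero_mul := fun x => LinearMap.map_zero₂ mulLin x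
    mul_zero := fun x => map_zero (mulLin x) }

noncomputable instance : Algebra R (PartitionAlgebra R δ r) :=
  Algebra.ofModule (fun c x y => LinearMap.map_smul₂ mulLin c x y)
    (fun c x y => map_smul (mulLin x) c y)

theorem diag_mul_diag (d₁ d₂ : PartitionDiagram r) :
    (diag d₁ * diag d₂ : PartitionAlgebra R δ r) = δ ^ loops d₁ d₂ • diag (comp d₁ d₂) :=
  mulLin_diag d₁ d₂

theorem one_eq_diag : (1 : PartitionAlgebra R δ r) = diag (ofPerm 1) := rfl

/-- The element `s_i`, for `1 ≤ i < r`, which exchanges the strands `i` and `i + 1`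
(and `1` for other `i`). -/
noncomputable def s (i : ℕ) : PartitionAlgebra R δ r :=
  if h : 1 ≤ i ∧ i < r then
    diag (ofPerm (Equiv.swap ⟨i - 1, by omega⟩ ⟨i, h.2⟩))
  else 1

/-- The element `p_i`, for `1 ≤ i ≤ r`, with blocks `{i}`, `{i'}` and `{a, a'}` for `a ≠ i`
(and `1` for other `i`). -/
noncomputable def p (i : ℕ) : PartitionAlgebra R δ r :=
  if h : 1 ≤ i ∧ i ≤ r then diag (cut ⟨i - 1, by omega⟩) else 1

/-- The element `p_{i + 1/2}`, for `1 ≤ i < r`, with blocks `{i, i + 1, i', (i + 1)'}` and `{a, a'}`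
for `a ≠ i, i + 1` (and `1` for other `i`). -/
noncomputable def pHalf (i : ℕ) : PartitionAlgebra R δ r :=
  if h : 1 ≤ i ∧ i < r then diag (join ⟨i - 1, by omega⟩ ⟨i, h.2⟩) else 1

end Algebra

section Generic

/-- The partition algebra `𝒜_r(z)` over `ℤ[z]`, where `z` is an indeterminate. -/
abbrev Generic (r : ℕ) : Type := PartitionAlgebra (Polynomial ℤ) Polynomial.X r

variable {r : ℕ}

mutual

/-- `JM i` is the Jucys-Murphy element `L_i`, for `0 ≤ i ≤ r`. -/
noncomputable def JM : ℕ → Generic r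
  | 0 => 0
  | 1 => p 1
  | i + 2 =>
    - s (i + 1) * JM (i + 1) * pHalf (i + 1)
    - pHalf (i + 1) * JM (i + 1) * s (i + 1)
    + pHalf (i + 1) * JM (i + 1) * p (i + 2) * pHalf (i + 1)
    + s (i + 1) * JM (i + 1) * s (i + 1)
    + sigmaSucc (i + 1)

/-- `sigmaSucc i` is the element `σ_{i + 1}`, for `0 ≤ i < r`. -/
noncomputable def sigmaSucc : ℕ → Generic r
  | 0 => 1
  | 1 => s 1
  | i + 2 =>
    s (i + 1) * s (i + 2) * sigmaSucc (i + 1) * s (i + 2) * s (i + 1)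
    + s (i + 2) * pHalf (i + 1) * JM (i + 1) * s (i + 2) * pHalf (i + 1) * s (i + 2)
    + pHalf (i + 1) * JM (i + 1) * s (i + 2) * pHalf (i + 1)
    - s (i + 2) * pHalf (i + 1) * JM (i + 1) * s (i + 1) * pHalf (i + 2) * p (i + 2)
        * pHalf (i + 1)
    - pHalf (i + 1) * p (i + 2) * pHalf (i + 2) * s (i + 1) * JM (i + 1) * pHalf (i + 1)
        * s (i + 2)

end

/-- `sigmaHalf i` is the element `σ_{i + 1/2}`, for `0 ≤ i < r`. -/
noncomputable def sigmaHalf : ℕ → Generic r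
  | 0 => 1
  | 1 => 1
  | i + 2 =>
    s (i + 1) * s (i + 2) * sigmaHalf (i + 1) * s (i + 2) * s (i + 1)
    + pHalf (i + 1) * JM (i + 1) * s (i + 2) * pHalf (i + 1) * s (i + 2)
    + s (i + 2) * pHalf (i + 1) * JM (i + 1) * s (i + 2) * pHalf (i + 1)
    - pHalf (i + 1) * JM (i + 1) * s (i + 1) * pHalf (i + 2) * p (i + 2) * pHalf (i + 1)
    - s (i + 2) * pHalf (i + 1) * p (i + 2) * pHalf (i + 2) * s (i + 1) * JM (i + 1)
        * pHalf (i + 1) * s (i + 2)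

/-- `JMHalf i` is the Jucys-Murphy element `L_{i + 1/2}`, for `0 ≤ i < r`. -/
noncomputable def JMHalf : ℕ → Generic r
  | 0 => 0
  | i + 1 =>
    - JM (i + 1) * pHalf (i + 1)
    - pHalf (i + 1) * JM (i + 1)
    + pHalf (i + 1) * JM (i + 1) * p (i + 1) * pHalf (i + 1)
    + s (i + 1) * JMHalf i * s (i + 1)
    + sigmaHalf (i + 1)

end Generic

section Action

open Polynomial

variable {r : ℕ}

/-- The linear map from the partition algebra with parameter `n` which sends a diagram to its
matrix, indexed by colourings of the top and of the bottom row. -/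
noncomputable def matrixLin (n r : ℕ) :
    PartitionAlgebra ℂ (n : ℂ) r →ₗ[ℂ] Matrix (Fin r → Fin n) (Fin r → Fin n) ℂ :=
  (diagramBasis ℂ (n : ℂ) r).constr ℂ fun d => Matrix.of fun a b => (d.entry a b : ℂ)

theorem matrixLin_diag (n r : ℕ) (d : PartitionDiagram r) :
    matrixLin n r (diag d) = Matrix.of fun a b => (d.entry a b : ℂ) := by
  simp only [matrixLin, diag, Module.Basis.constr_basis]

theorem matrixLin_mul (n r : ℕ) (x y : PartitionAlgebra ℂ (n : ℂ) r) :
    matrixLin n r (x * y) = matrixLin n r x * matrixLin n r y := by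
  induction x using induction_diag with
  | h0 => simp
  | ha x x' h h' => simp [h, h', add_mul]
  | hs c x h => simp [h]
  | hd d₁ =>
    induction y using induction_diag with
    | h0 => simp
    | ha x x' h h' => simp [h, h', mul_add]
    | hs c x h => simp [h]
    | hd d₂ =>
      rw [diag_mul_diag, map_smul, matrixLin_diag, matrixLin_diag, matrixLin_diag]
      ext a b
      have h := sum_entry d₁ d₂ a b
      rw [Fintype.card_fin] at h
      simp only [Matrix.smul_apply, Matrix.of_apply, Matrix.mul_apply, smul_eq_mul]
      exact_mod_cast h.symm

theorem matrixLin_one (n r : ℕ) : matrixLin n r 1 = 1 := by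
  rw [one_eq_diag, matrixLin_diag]
  ext a b
  simp [entry_ofPerm, Matrix.one_apply]

/-- The additive map which evaluates the coefficients with respect to the diagram basis
at `z = n`. -/
noncomputable def specializeAdd (n r : ℕ) : Generic r →+ PartitionAlgebra ℂ (n : ℂ) r :=
  (Finsupp.mapRange.addMonoidHom (aeval (R := ℤ) (n : ℂ)).toAddMonoidHom :
    (PartitionDiagram r →₀ Polynomial ℤ) →+ (PartitionDiagram r →₀ ℂ))

theorem specializeAdd_smul (n r : ℕ) (c : Polynomial ℤ) (x : Generic r) :
    specializeAdd n r (c • x) = aeval (n : ℂ) c • specializeAdd n r x := by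
  refine Finsupp.ext fun d => ?_
  change aeval (n : ℂ) (c * (show PartitionDiagram r →₀ Polynomial ℤ from x) d) = _
  rw [map_mul]
  rfl

theorem specializeAdd_diag (n r : ℕ) (d : PartitionDiagram r) :
    specializeAdd n r (diag d) = diag d := by
  change Finsupp.mapRange (aeval (R := ℤ) (n : ℂ)) (map_zero _)
    (Finsupp.single d (1 : Polynomial ℤ)) = Finsupp.single d (1 : ℂ)
  rw [Finsupp.mapRange_single, map_one]

theorem specializeAdd_mul (n r : ℕ) (x y : Generic r) :
    specializeAdd n r (x * y) = specializeAdd n r x * specializeAdd n r y := by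
  induction x using induction_diag with
  | h0 => simp
  | ha x x' h h' => simp [h, h', add_mul]
  | hs c x h => rw [smul_mul_assoc, specializeAdd_smul, specializeAdd_smul, h, smul_mul_assoc]
  | hd d₁ =>
    induction y using induction_diag with
    | h0 => simp
    | ha x x' h h' => simp [h, h', mul_add]
    | hs c x h => rw [mul_smul_comm, specializeAdd_smul, specializeAdd_smul, h, mul_smul_comm]
    | hd d₂ =>
      rw [diag_mul_diag, specializeAdd_smul, specializeAdd_diag, specializeAdd_diag,
        specializeAdd_diag, diag_mul_diag, map_pow, aeval_X]

/-- The canonical ring homomorphism from `𝒜_r(z)` to its base change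
`A_r(n) = 𝒜_r(z) ⊗_{ℤ[z]} ℂ`, where `z` acts on `ℂ` as `n`: the algebra `A_r(n)` has the diagrams
as a basis over `ℂ`, with parameter `n`, and the homomorphism evaluates coefficients at `z = n`. -/
noncomputable def specialize (n r : ℕ) : Generic r →+* PartitionAlgebra ℂ (n : ℂ) r :=
  { specializeAdd n r with
    map_one' := specializeAdd_diag n r _
    map_mul' := specializeAdd_mul n r }

variable {V : Type*} [AddCommGroup V] [Module ℂ V] {n : ℕ}

/-- The action of `A_r(n)` on the tensor power `V^{⊗ r}` of a vector space with basis
`v_1, …, v_n`: a diagram `d` sends `⨂ v_{b_j}` to the sum of `⨂ v_{a_j}` over all `a` for which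
the colouring of the top row by `a` and of the bottom row by `b` is constant on the blocks
of `d`. -/
noncomputable def action (v : Module.Basis (Fin n) ℂ V) (r : ℕ) :
    PartitionAlgebra ℂ (n : ℂ) r →ₐ[ℂ] Module.End ℂ (⨂[ℂ] _ : Fin r, V) :=
  (Matrix.toLinAlgEquiv (Basis.piTensorProduct fun _ : Fin r => v)).toAlgHom.comp
    (AlgHom.ofLinearMap (matrixLin n r) (matrixLin_one n r) (matrixLin_mul n r))

/-- The operator on `V^{⊗ r}` by which an element of `𝒜_r(z)` acts through `A_r(n)`. -/
noncomputable def act (v : Module.Basis (Fin n) ℂ V) {r : ℕ} (x : Generic r) :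
    Module.End ℂ (⨂[ℂ] _ : Fin r, V) :=
  action v r (specialize n r x)

/-- The transposition `s_{i,j}` of `𝔖_n` (the identity if `i = j`) acting on `V`. -/
noncomputable def transposition (v : Module.Basis (Fin n) ℂ V) (i j : Fin n) : V →ₗ[ℂ] V :=
  (v.equiv v (Equiv.swap i j)).toLinearMap

end Action

end PartitionAlgebra

namespace PartitionAlgebra

open PartitionDiagram Polynomial

variable {n : ℕ} {V : Type*} [AddCommGroup V] [Module ℂ V] (v : Module.Basis (Fin n) ℂ V) {r : ℕ}

-- Everything is checked on basis tensors, that is, on colourings of the positions. There each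
-- generator is local: `s` exchanges two adjacent colours, `p` sums over all replacements of one
-- colour, and `pHalf` keeps the tensors with two equal adjacent colours and kills the others.
--
-- In each recursion the term conjugated by `s` carries the previous operator one position further.
-- The transposition then acts on all earlier colours except the one, `u`, that was carried past.
-- This is already correct unless the transposition moves `u`. The terms containing `pHalf` are
-- nonzero only when certain colours coincide; they remove the wrong tensor and insert the right
-- one. The steps `sigmaSucc_succ`, `sigmaHalf_succ`, `JM_succ` and `JMHalf_succ` are case
-- distinctions on these coincidences.
--
-- The integral `L` and `σ` call each other and need a joint induction (`JMAct_and_SigmaSuccAct`).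
-- The half-integral ones use the integral `L` but are not used by them, so they follow afterwards.

-- Generators acting on basis tensors.

theorem act_zero : act v (0 : Generic r) = 0 := by simp [act]

theorem act_one : act v (1 : Generic r) = 1 := by simp [act]

theorem act_neg (x : Generic r) : act v (-x) = -act v x := by simp [act]

theorem act_add (x y : Generic r) : act v (x + y) = act v x + act v y := by simp [act]

theorem act_sub (x y : Generic r) : act v (x - y) = act v x - act v y := by simp [act]

theorem act_mul (x y : Generic r) : act v (x * y) = act v x * act v y := by simp [act]

/-- The basis tensor of `V^{⊗ r}` given by the first `r` values of a colouring of `ℕ`. -/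
noncomputable def tens (v : Module.Basis (Fin n) ℂ V) (r : ℕ) (c : ℕ → Fin n) :
    ⨂[ℂ] _ : Fin r, V :=
  ⨂ₜ[ℂ] a : Fin r, v (c a)

theorem act_diag_tprod (d : PartitionDiagram r) (b : Fin r → Fin n) :
    act v (diag d : Generic r) (⨂ₜ[ℂ] a, v (b a)) =
      ∑ a : Fin r → Fin n, (d.entry a b : ℂ) • ⨂ₜ[ℂ] j, v (a j) := by
  have h : specialize n r (diag d) = diag d := specializeAdd_diag n r d
  have hb : ∀ a : Fin r → Fin n,
      (⨂ₜ[ℂ] j, v (a j)) = (Basis.piTensorProduct fun _ : Fin r => v) a := fun a => by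
    rw [Basis.piTensorProduct_apply]
  rw [act, h]
  simp only [hb]
  change Matrix.toLinAlgEquiv (Basis.piTensorProduct fun _ : Fin r => v)
    (matrixLin n r (diag d)) _ = _
  rw [Matrix.toLinAlgEquiv_self, matrixLin_diag]
  rfl

/-- Positions of a colouring count from `0` and generators from `1`, hence the shift of index here
and below. -/
theorem act_s_tens {i : ℕ} (hi : i + 1 < r) (c : ℕ → Fin n) :
    act v (s (i + 1) : Generic r) (tens v r c) = tens v r (c ∘ Equiv.swap i (i + 1)) := by
  rw [s, dif_pos ⟨by omega, hi⟩, tens, act_diag_tprod]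
  simp only [entry_ofPerm, Nat.cast_ite, Nat.cast_one, Nat.cast_zero, ite_smul, one_smul,
    zero_smul, Finset.sum_ite_eq', Finset.mem_univ, if_true]
  refine congrArg _ (funext fun a => congrArg v (congrArg c ?_))
  simp only [Equiv.swap_apply_def, Fin.ext_iff]
  split_ifs <;> simp_all

theorem act_p_tens {i : ℕ} (hi : i < r) (c : ℕ → Fin n) :
    act v (p (i + 1) : Generic r) (tens v r c) = ∑ m, tens v r (Function.update c i m) := by
  rw [p, dif_pos ⟨by omega, hi⟩, tens, act_diag_tprod]
  have key : ∀ a : Fin r → Fin n, (cut (⟨i, hi⟩ : Fin r)).entry a (fun j => c j) =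
      if a = Function.update (fun j : Fin r => c j) ⟨i, hi⟩ (a ⟨i, hi⟩) then 1 else 0 := by
    intro a
    split_ifs with h
    · refine entry_pos ?_
      have h1 : ∀ j, j ≠ ⟨i, hi⟩ → a j = c j := fun j hj => by
        rw [h, Function.update_of_ne hj]
      -- `cut` is the kernel of a map choosing a representative in each block; it suffices that
      -- every vertex has the colour of its representative.
      have h2 : ∀ z, Sum.elim a (fun j : Fin r => c j) z =
          Sum.elim a (fun j : Fin r => c j) (Sum.elim Sum.inl
            (fun a => if a = (⟨i, hi⟩ : Fin r) then Sum.inr a else Sum.inl a) z) := by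
        rintro (z | z)
        · rfl
        · by_cases hz : z = ⟨i, hi⟩ <;> simp [hz, h1]
      intro x y hxy
      rw [h2 x, h2 y]
      exact congrArg _ hxy
    · refine entry_neg fun h' => h (funext fun j => ?_)
      by_cases hj : j = ⟨i, hi⟩
      · simp [hj]
      · rw [Function.update_of_ne hj]
        refine h' (Sum.inl j) (Sum.inr j) ?_
        change Sum.inl j = ite _ _ _
        rw [if_neg hj]
  simp only [Nat.add_sub_cancel, key, Nat.cast_ite, Nat.cast_one, Nat.cast_zero, ite_smul,
    one_smul, zero_smul, ← Finset.sum_filter]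
  symm
  -- The admissible top colourings are parametrised by their colour `m` at the cut position.
  refine Finset.sum_bij (fun m _ => Function.update (fun j : Fin r => c j) ⟨i, hi⟩ m) ?_ ?_ ?_ ?_
  · simp
  · intro m _ m' _ h
    simpa using congrFun h ⟨i, hi⟩
  · intro a ha
    exact ⟨a ⟨i, hi⟩, Finset.mem_univ _, (Finset.mem_filter.1 ha).2.symm⟩
  · intro m _
    refine congrArg _ (funext fun a => congrArg v ?_)
    simp only [Function.update_apply, Fin.ext_iff]

theorem act_pHalf_tens {i : ℕ} (hi : i + 1 < r) (c : ℕ → Fin n) :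
    act v (pHalf (i + 1) : Generic r) (tens v r c) =
      if c i = c (i + 1) then tens v r c else 0 := by
  rw [pHalf, dif_pos ⟨by omega, hi⟩, tens, act_diag_tprod]
  have key : ∀ a : Fin r → Fin n,
      (join (⟨i, by omega⟩ : Fin r) ⟨i + 1, hi⟩).entry a (fun j => c j) =
      if a = (fun j : Fin r => c j) then (if c i = c (i + 1) then 1 else 0) else 0 := by
    intro a
    rw [← ite_and]
    split_ifs with h
    · refine entry_pos ?_
      obtain ⟨rfl, h⟩ := h
      have h2 : ∀ z, Sum.elim (fun j : Fin r => c j) (fun j : Fin r => c j) z =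
          c (Sum.elim (fun a => if a = (⟨i + 1, hi⟩ : Fin r) then ⟨i, by omega⟩ else a)
            (fun a => if a = (⟨i + 1, hi⟩ : Fin r) then ⟨i, by omega⟩ else a) z : Fin r) := by
        rintro (z | z) <;> by_cases hz : z = ⟨i + 1, hi⟩ <;> simp [hz, h]
      intro x y hxy
      rw [h2 x, h2 y]
      exact congrArg (fun z : Fin r => c z) hxy
    · refine entry_neg fun h' => h ⟨funext fun j => h' (Sum.inl j) (Sum.inr j) rfl, ?_⟩
      refine h' (Sum.inr ⟨i, by omega⟩) (Sum.inr ⟨i + 1, hi⟩) ?_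
      change ite _ _ _ = ite _ _ _
      simp
  simp only [Nat.add_sub_cancel, key, Nat.cast_ite, Nat.cast_one, Nat.cast_zero, ite_smul,
    one_smul, zero_smul, Finset.sum_ite_eq', Finset.mem_univ, if_true]

-- Colourings split into an initial segment and a tail.

/-- The sequence `t` with `x` put in front. -/
def scons {C : Type*} (x : C) (t : ℕ → C) : ℕ → C
  | 0 => x
  | a + 1 => t a

/-- The basis tensor whose colours are `w` at the positions below `k`, followed by `t`. -/
noncomputable def splice (v : Module.Basis (Fin n) ℂ V) (r k : ℕ) (w t : ℕ → Fin n) :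
    ⨂[ℂ] _ : Fin r, V :=
  tens v r fun a => if a < k then w a else t (a - k)

local infixr:67 " ∷ " => scons

/-- Used to pass from `k + 1` to `k` in the recursion: the colour to be carried past becomes visible
in the tail, where the generators act. -/
theorem splice_succ (k : ℕ) (w t : ℕ → Fin n) :
    splice v r (k + 1) w t = splice v r k w (w k ∷ t) := by
  refine congrArg (tens v r) (funext fun a => ?_)
  rcases lt_trichotomy a k with h | rfl | h
  · simp [h, h.trans (Nat.lt_succ_self k)]
  · simp [scons]
  · obtain ⟨b, rfl⟩ := Nat.exists_eq_add_of_lt h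
    rw [if_neg (by omega), if_neg (by omega), show k + b + 1 - k = b + 1 by omega,
      show k + b + 1 - (k + 1) = b by omega]
    rfl

theorem splice_congr {k : ℕ} {w w' t : ℕ → Fin n} (h : ∀ a < k, w a = w' a) :
    splice v r k w t = splice v r k w' t := by
  refine congrArg (tens v r) (funext fun a => ?_)
  split_ifs with ha
  · exact h a ha
  · rfl

theorem splice_self (k : ℕ) (w : ℕ → Fin n) :
    splice v r k w (fun a => w (a + k)) = tens v r w := by
  refine congrArg (tens v r) (funext fun a => ?_)
  split_ifs with ha
  · rfl
  · exact congrArg w (Nat.sub_add_cancel (by omega))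

variable {k : ℕ} (w e : ℕ → Fin n) (u x y : Fin n)

theorem act_s_splice (h : k + 1 < r) :
    act v (s (k + 1) : Generic r) (splice v r k w (x ∷ y ∷ e)) =
      splice v r k w (y ∷ x ∷ e) := by
  rw [splice, act_s_tens v h]
  refine congrArg (tens v r) (funext fun a => ?_)
  rcases lt_trichotomy a k with h | rfl | h
  · simp [Equiv.swap_apply_of_ne_of_ne (show a ≠ k by omega) (show a ≠ k + 1 by omega), h]
  · simp [scons]
  · obtain ⟨b, rfl⟩ := Nat.exists_eq_add_of_lt h
    rcases b with _ | b
    · simp [scons]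
    · rw [Function.comp, Equiv.swap_apply_of_ne_of_ne (by omega) (by omega), if_neg (by omega),
        if_neg (by omega), show k + (b + 1) + 1 - k = b + 2 by omega]
      rfl

theorem act_p_splice (h : k < r) :
    act v (p (k + 1) : Generic r) (splice v r k w (x ∷ e)) =
      ∑ m, splice v r k w (m ∷ e) := by
  rw [splice, act_p_tens v h]
  refine Finset.sum_congr rfl fun m _ => congrArg _ (funext fun a => ?_)
  rcases lt_trichotomy a k with h | rfl | h
  · simp [h, h.ne]
  · simp [scons]
  · obtain ⟨b, rfl⟩ := Nat.exists_eq_add_of_lt h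
    rw [Function.update_of_ne (by omega), if_neg (by omega),
        if_neg (by omega), show k + b + 1 - k = b + 1 by omega]
    rfl

theorem act_pHalf_splice (h : k + 1 < r) :
    act v (pHalf (k + 1) : Generic r) (splice v r k w (x ∷ y ∷ e)) =
      if x = y then splice v r k w (x ∷ y ∷ e) else 0 := by
  rw [splice, act_pHalf_tens v h]
  simp [scons]

/-- The first colour of the tail may be moved to the end of the initial part. -/
theorem splice_scons (t : ℕ → Fin n) :
    splice v r k w (u ∷ t) = splice v r (k + 1) (Function.update w k u) t := by
  rw [splice_succ, Function.update_self]
  exact splice_congr v fun a ha => by rw [Function.update_of_ne ha.ne]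

theorem act_s_splice_succ (h : k + 2 < r) :
    act v (s (k + 2) : Generic r) (splice v r k w (u ∷ x ∷ y ∷ e)) =
      splice v r k w (u ∷ y ∷ x ∷ e) := by
  rw [splice_scons, act_s_splice v _ _ _ _ h, ← splice_scons]

theorem act_p_splice_succ (h : k + 1 < r) :
    act v (p (k + 2) : Generic r) (splice v r k w (u ∷ x ∷ e)) =
      ∑ m, splice v r k w (u ∷ m ∷ e) := by
  simp only [splice_scons v w u, act_p_splice v _ _ _ h]

theorem act_pHalf_splice_succ (h : k + 2 < r) :
    act v (pHalf (k + 2) : Generic r) (splice v r k w (u ∷ x ∷ y ∷ e)) =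
      if x = y then splice v r k w (u ∷ x ∷ y ∷ e) else 0 := by
  simp only [splice_scons v w u, act_pHalf_splice v _ _ _ _ h]

-- The four operator formulas and their recursion steps.

/-- The element `L_{k + 1}` acts on the first `k` colours by a sum of transpositions, and
replaces the next colour. -/
def JMAct (v : Module.Basis (Fin n) ℂ V) (r k : ℕ) : Prop :=
  ∀ (w e : ℕ → Fin n) (x : Fin n), act v (JM (k + 1) : Generic r) (splice v r k w (x ∷ e)) =
    ∑ j, splice v r k (Equiv.swap x j ∘ w) (j ∷ e)

/-- The element `σ_{k + 2}` acts by exchanging two colours at the first `k + 2` positions. -/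
def SigmaSuccAct (v : Module.Basis (Fin n) ℂ V) (r k : ℕ) : Prop :=
  ∀ (w e : ℕ → Fin n) (x y : Fin n),
    act v (sigmaSucc (k + 1) : Generic r) (splice v r k w (x ∷ y ∷ e)) =
      splice v r k (Equiv.swap x y ∘ w) (y ∷ x ∷ e)

/-- The element `σ_{k + 3/2}` acts by exchanging two colours at the first `k` positions. -/
def SigmaHalfAct (v : Module.Basis (Fin n) ℂ V) (r k : ℕ) : Prop :=
  ∀ (w e : ℕ → Fin n) (x y : Fin n),
    act v (sigmaHalf (k + 1) : Generic r) (splice v r k w (x ∷ y ∷ e)) =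
      splice v r k (Equiv.swap x y ∘ w) (x ∷ y ∷ e)

/-- The element `L_{k + 1/2}` acts on colourings as `n` minus a sum of transpositions
of the first `k` colours. -/
def JMHalfAct (v : Module.Basis (Fin n) ℂ V) (r k : ℕ) : Prop :=
  ∀ (w e : ℕ → Fin n) (x : Fin n), act v (JMHalf k : Generic r) (splice v r k w (x ∷ e)) =
    (n : ℂ) • splice v r k w (x ∷ e) - ∑ j, splice v r k (Equiv.swap x j ∘ w) (x ∷ e)

variable {v}


/-- On a tail `u, x, y` the conjugated term gives `u, y, x` with the earlier colours transposed. If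
`u = x`, the third term gives the correct `y, y, x` and the fourth cancels the first; if `u = y`,
the second and fifth terms do the same. -/
theorem sigmaSucc_succ (h : k + 2 < r) (hL : JMAct v r k) (hS : SigmaSuccAct v r k) :
    SigmaSuccAct v r (k + 1) := by
  intro w e x y
  rw [splice_succ, splice_succ]
  generalize hu : w k = u
  simp only [Function.comp_apply, hu]
  rw [sigmaSucc]
  simp only [act_add, act_sub, act_mul, LinearMap.add_apply, LinearMap.sub_apply,
    Module.End.mul_apply, act_s_splice v _ _ _ _ (show k + 1 < r by omega),
    act_s_splice_succ v _ _ _ _ _ h, act_pHalf_splice v _ _ _ _ (show k + 1 < r by omega),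
    act_pHalf_splice_succ v _ _ _ _ _ h, act_p_splice_succ v _ _ _ _ (show k + 1 < r by omega),
    hS _, hL _, map_sum, apply_ite (act v _), map_zero, Finset.sum_ite_eq, Finset.sum_ite_eq',
    Finset.mem_univ, if_true]
  by_cases hux : u = x
  · subst hux
    by_cases huy : u = y
    · subst huy
      -- All five terms are the same tensor, with signs `+ + + - -`.
      simp
    · simp [huy, Equiv.swap_comm y u]
  · by_cases huy : u = y
    · subst huy
      simp [hux, Equiv.swap_comm u x]
    · simp [hux, huy, Equiv.swap_apply_of_ne_of_ne]

/-- The cancellation is that of `sigmaSucc_succ`, with the last two colours left in the order `x,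
y`. -/
theorem sigmaHalf_succ (h : k + 2 < r) (hL : JMAct v r k) (hS : SigmaHalfAct v r k) :
    SigmaHalfAct v r (k + 1) := by
  intro w e x y
  rw [splice_succ, splice_succ]
  generalize hu : w k = u
  simp only [Function.comp_apply, hu]
  rw [sigmaHalf]
  simp only [act_add, act_sub, act_mul, LinearMap.add_apply, LinearMap.sub_apply,
    Module.End.mul_apply, act_s_splice v _ _ _ _ (show k + 1 < r by omega),
    act_s_splice_succ v _ _ _ _ _ h, act_pHalf_splice v _ _ _ _ (show k + 1 < r by omega),
    act_pHalf_splice_succ v _ _ _ _ _ h, act_p_splice_succ v _ _ _ _ (show k + 1 < r by omega),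
    hS _, hL _, map_sum, apply_ite (act v _), map_zero, Finset.sum_ite_eq, Finset.sum_ite_eq',
    Finset.mem_univ, if_true]
  by_cases hux : u = x
  · subst hux
    by_cases huy : u = y
    · subst huy
      simp
    · simp [huy, Equiv.swap_comm y u]
  · by_cases huy : u = y
    · subst huy
      simp [hux, Equiv.swap_comm u x]
    · simp [hux, huy, Equiv.swap_apply_of_ne_of_ne]

/-- On a tail `x, y` the conjugated term gives the tails `x, j`. For `x ≠ y` only `j = x` is wrong:
`- pHalf * JM * s` removes it and `σ` supplies `y, x`. For `x = y` the whole sum is cancelled by `-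
s * JM * pHalf`, the term with `p` supplies the tails `j, j`, and `- pHalf * JM * s` cancels `σ`. -/
theorem JM_succ (h : k + 1 < r) (hL : JMAct v r k) (hS : SigmaSuccAct v r k) :
    JMAct v r (k + 1) := by
  intro w e y
  simp only [splice_succ]
  generalize hx : w k = x
  simp only [Function.comp_apply, hx]
  rw [JM]
  simp only [act_add, act_sub, act_neg, act_mul, LinearMap.add_apply, LinearMap.sub_apply,
    LinearMap.neg_apply, Module.End.mul_apply, act_s_splice v _ _ _ _ h,
    act_pHalf_splice v _ _ _ _ h, act_p_splice_succ v _ _ _ _ h,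
    hS _, hL _, map_sum, apply_ite (act v _), map_zero, Finset.sum_ite_eq',
    Finset.mem_univ, if_true]
  by_cases hxy : x = y
  · subst hxy
    simp
    abel
  -- The summand `j = x` is split off, since `Equiv.swap y j` fixes `x` for every other `j`.
  · have hL : ∀ f : Fin n → ⨂[ℂ] _ : Fin r, V, ∑ j, f j = f x + ∑ j ∈ Finset.univ.erase x, f j :=
      fun f => (Finset.add_sum_erase _ _ (Finset.mem_univ x)).symm
    have hj : ∑ j ∈ Finset.univ.erase x,
        splice v r k (Equiv.swap y j ∘ w) (Equiv.swap y j x ∷ j ∷ e) =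
        ∑ j ∈ Finset.univ.erase x, splice v r k (Equiv.swap y j ∘ w) (x ∷ j ∷ e) :=
      Finset.sum_congr rfl fun j hj => by
        rw [Equiv.swap_apply_of_ne_of_ne hxy (Finset.ne_of_mem_erase hj).symm]
    rw [if_neg hxy, if_neg hxy, hL, hL, hj, Equiv.swap_apply_right, Equiv.swap_comm x y]
    abel

/-- The conjugated term already gives the multiple by `n`. For `x ≠ y` its summand `j = x` is
cancelled by `σ`, and `- pHalf * JM` supplies the tail `y, y`. For `x = y` the term with `p` cancels
its sum, `- JM * pHalf` supplies the right one, and `- pHalf * JM` cancels `σ`. -/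
theorem JMHalf_succ (h : k + 1 < r) (hL : JMAct v r k) (hL' : JMHalfAct v r k)
    (hS : SigmaHalfAct v r k) : JMHalfAct v r (k + 1) := by
  intro w e y
  simp only [splice_succ]
  generalize hx : w k = x
  simp only [Function.comp_apply, hx]
  rw [JMHalf]
  simp only [act_add, act_sub, act_neg, act_mul, LinearMap.add_apply, LinearMap.sub_apply,
    LinearMap.neg_apply, Module.End.mul_apply, act_s_splice v _ _ _ _ h,
    act_pHalf_splice v _ _ _ _ h, act_p_splice v _ _ _ (show k < r by omega),
    hS _, hL _, hL' _, map_sum, map_sub, map_smul, apply_ite (act v _), map_zero,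
    Finset.sum_ite_eq', Finset.mem_univ, if_true]
  by_cases hxy : x = y
  · subst hxy
    have hc : ∑ j, splice v r k (Equiv.swap j x ∘ w) (x ∷ x ∷ e) =
        ∑ j, splice v r k (Equiv.swap x j ∘ w) (x ∷ x ∷ e) :=
      Finset.sum_congr rfl fun j _ => by rw [Equiv.swap_comm]
    simp only [if_true, Equiv.swap_self, Equiv.coe_refl, Function.id_comp, Equiv.swap_apply_left,
      hc]
    abel
  · have hL : ∀ f : Fin n → ⨂[ℂ] _ : Fin r, V, ∑ j, f j = f x + ∑ j ∈ Finset.univ.erase x, f j :=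
      fun f => (Finset.add_sum_erase _ _ (Finset.mem_univ x)).symm
    have hj : ∑ j ∈ Finset.univ.erase x,
        splice v r k (Equiv.swap y j ∘ w) (Equiv.swap y j x ∷ y ∷ e) =
        ∑ j ∈ Finset.univ.erase x, splice v r k (Equiv.swap y j ∘ w) (x ∷ y ∷ e) :=
      Finset.sum_congr rfl fun j hj => by
        rw [Equiv.swap_apply_of_ne_of_ne hxy (Finset.ne_of_mem_erase hj).symm]
    simp only [if_neg hxy]
    rw [hL, hL, hj, Equiv.swap_apply_right, Equiv.swap_comm x y]
    simp
    abel

-- Base cases and inductions.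

theorem JMAct_zero (h : 0 < r) : JMAct v r 0 := by
  intro w e x
  rw [JM, act_p_splice v _ _ _ h]
  exact Finset.sum_congr rfl fun j _ => splice_congr v (by simp)

theorem SigmaSuccAct_zero (h : 1 < r) : SigmaSuccAct v r 0 := by
  intro w e x y
  rw [sigmaSucc, act_s_splice v _ _ _ _ h]
  exact splice_congr v (by simp)

theorem SigmaHalfAct_zero : SigmaHalfAct v r 0 := by
  intro w e x y
  rw [sigmaHalf, act_one, Module.End.one_apply]
  exact splice_congr v (by simp)

/-- With no earlier colours, all `n` summands equal the given tensor, so the formula reads `n - n =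
0`. -/
theorem JMHalfAct_zero : JMHalfAct v r 0 := by
  intro w e x
  have h : ∀ j, splice v r 0 (Equiv.swap x j ∘ w) (x ∷ e) = splice v r 0 w (x ∷ e) :=
    fun j => splice_congr v (by simp)
  simp [JMHalf, act_zero, h, Nat.cast_smul_eq_nsmul]

theorem JMAct_and_SigmaSuccAct (k : ℕ) :
    (k < r → JMAct v r k) ∧ (k + 1 < r → SigmaSuccAct v r k) := by
  induction k with
  | zero => exact ⟨JMAct_zero, SigmaSuccAct_zero⟩
  | succ k ih =>
    exact ⟨fun h => JM_succ h (ih.1 (by omega)) (ih.2 h),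
      fun h => sigmaSucc_succ h (ih.1 (by omega)) (ih.2 (by omega))⟩

theorem SigmaHalfAct_of_lt {k : ℕ} (h : k + 1 < r) : SigmaHalfAct v r k := by
  induction k with
  | zero => exact SigmaHalfAct_zero
  | succ k ih =>
    exact sigmaHalf_succ h ((JMAct_and_SigmaSuccAct k).1 (by omega)) (ih (by omega))

theorem JMHalfAct_of_lt {k : ℕ} (h : k < r) : JMHalfAct v r k := by
  induction k with
  | zero => exact JMHalfAct_zero
  | succ k ih =>
    exact JMHalf_succ h ((JMAct_and_SigmaSuccAct k).1 (by omega)) (ih (by omega))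
      (SigmaHalfAct_of_lt h)

-- Return from colourings of `ℕ` to colourings of `Fin`.

variable (v)

theorem tens_eq_splice (k : ℕ) (c : ℕ → Fin n) :
    tens v r c = splice v r k c (c k ∷ fun a => c (a + (k + 1))) := by
  rw [← splice_succ, splice_self]

theorem tens_eq_splice_two (k : ℕ) (c : ℕ → Fin n) :
    tens v r c = splice v r k c (c k ∷ c (k + 1) ∷ fun a => c (a + (k + 2))) := by
  rw [← splice_succ, ← splice_succ, splice_self]

theorem transposition_basis (i j a : Fin n) :
    transposition v i j (v a) = v (Equiv.swap i j a) := by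
  simp [transposition]

/-- The colouring of `ℕ` which extends a colouring of `r + 1` positions. -/
def extend {C : Type*} (i : Fin (r + 1) → C) (a : ℕ) : C :=
  -- The default `i 0` is never read by `tens v (r + 1)`; having `r + 1` positions guarantees that
  -- it exists.
  if h : a < r + 1 then i ⟨a, h⟩ else i 0

theorem extend_val {C : Type*} (i : Fin (r + 1) → C) (a : Fin (r + 1)) : extend i a = i a :=
  dif_pos a.2

theorem extend_of_lt {C : Type*} (i : Fin (r + 1) → C) {a : ℕ} (h : a < r + 1) :
    extend i a = i ⟨a, h⟩ :=
  dif_pos h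

theorem tprod_eq_tens (i : Fin (r + 1) → Fin n) :
    (⨂ₜ[ℂ] a, v (i a)) = tens v (r + 1) (extend i) := by
  simp only [tens, extend_val]

end PartitionAlgebra

open PartitionAlgebra in
theorem mainTheorem11 {n : ℕ} {V : Type*} [AddCommGroup V] [Module ℂ V]
    (v : Module.Basis (Fin n) ℂ V) (k : ℕ) (hk : 1 ≤ k) :
    (∀ i : Fin (k + 1) → Fin n,
      PartitionAlgebra.act v (PartitionAlgebra.sigmaHalf k : PartitionAlgebra.Generic (k + 1))
          (⨂ₜ[ℂ] a, v (i a)) =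
        ⨂ₜ[ℂ] a : Fin (k + 1),
          if (a : ℕ) < k - 1 then
            PartitionAlgebra.transposition v (i ⟨k - 1, by omega⟩) (i ⟨k, by omega⟩) (v (i a))
          else v (i a)) ∧
    (∀ i : Fin (k + 1) → Fin n,
      PartitionAlgebra.act v (PartitionAlgebra.sigmaSucc k : PartitionAlgebra.Generic (k + 1))
          (⨂ₜ[ℂ] a, v (i a)) =
        ⨂ₜ[ℂ] a : Fin (k + 1),
          PartitionAlgebra.transposition v (i ⟨k - 1, by omega⟩) (i ⟨k, by omega⟩) (v (i a))) ∧
    (∀ i : Fin k → Fin n,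
      PartitionAlgebra.act v (PartitionAlgebra.JMHalf (k - 1) : PartitionAlgebra.Generic k) (⨂ₜ[ℂ] a, v (i a)) =
        (n : ℂ) • (⨂ₜ[ℂ] a, v (i a)) -
          ∑ j : Fin n, ⨂ₜ[ℂ] a : Fin k,
            if (a : ℕ) < k - 1 then
              PartitionAlgebra.transposition v (i ⟨k - 1, by omega⟩) j (v (i a))
            else v (i ⟨k - 1, by omega⟩)) ∧
    (∀ i : Fin k → Fin n,
      PartitionAlgebra.act v (PartitionAlgebra.JM k : PartitionAlgebra.Generic k)
          (⨂ₜ[ℂ] a, v (i a)) =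
        ∑ j : Fin n, ⨂ₜ[ℂ] a : Fin k,
          if (a : ℕ) < k - 1 then
            PartitionAlgebra.transposition v (i ⟨k - 1, by omega⟩) j (v (i a))
          else v j) := by
  -- From here `k` is one less than in the statement, hence the number of initial colours; the
  -- ambient `r` is `k + 2` for `σ` and `k + 1` for `L`.
  obtain ⟨k, rfl⟩ := Nat.exists_eq_add_of_le' hk
  refine ⟨fun i => ?_, fun i => ?_, fun i => ?_, fun i => ?_⟩
  · rw [tprod_eq_tens, tens_eq_splice_two v k, SigmaHalfAct_of_lt (by omega)]
    refine congrArg (PiTensorProduct.tprod ℂ) (funext fun a => ?_)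
    simp only [transposition_basis, Nat.add_sub_cancel, ← apply_ite v]
    refine congrArg v ?_
    rw [extend_of_lt i (show k < k + 1 + 1 by omega), extend_of_lt i (Nat.lt_succ_self _)]
    split_ifs with h
    · rw [Function.comp_apply, extend_val]
    · obtain ⟨a, ha⟩ := a
      -- Beyond the initial segment only the two tail positions remain.
      obtain rfl | rfl : a = k ∨ a = k + 1 := by simp only at h; omega
      all_goals simp [scons]
  · rw [tprod_eq_tens, tens_eq_splice_two v k, (JMAct_and_SigmaSuccAct k).2 (by omega)]
    refine congrArg (PiTensorProduct.tprod ℂ) (funext fun a => ?_)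
    simp only [transposition_basis, Nat.add_sub_cancel]
    refine congrArg v ?_
    rw [extend_of_lt i (show k < k + 1 + 1 by omega), extend_of_lt i (Nat.lt_succ_self _)]
    split_ifs with h
    · rw [Function.comp_apply, extend_val]
    · obtain ⟨a, ha⟩ := a
      obtain rfl | rfl : a = k ∨ a = k + 1 := by simp only at h; omega
      all_goals simp [scons]
  · simp only [Nat.add_sub_cancel]
    rw [tprod_eq_tens, tens_eq_splice v k, JMHalfAct_of_lt (by omega)]
    refine congrArg _ (Finset.sum_congr rfl fun j _ => congrArg (PiTensorProduct.tprod ℂ) (funext fun a => ?_))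
    simp only [transposition_basis, ← apply_ite v]
    refine congrArg v ?_
    rw [extend_of_lt i (Nat.lt_succ_self _)]
    split_ifs with h
    · rw [Function.comp_apply, extend_val]
    · rw [show (a : ℕ) - k = 0 by omega]
      rfl
  · rw [tprod_eq_tens, tens_eq_splice v k, (JMAct_and_SigmaSuccAct k).1 (by omega)]
    refine Finset.sum_congr rfl fun j _ => congrArg (PiTensorProduct.tprod ℂ) (funext fun a => ?_)
    simp only [transposition_basis, Nat.add_sub_cancel, ← apply_ite v]
    refine congrArg v ?_
    rw [extend_of_lt i (Nat.lt_succ_self _)]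
    split_ifs with h
    · rw [Function.comp_apply, extend_val]
    · rw [show (a : ℕ) - k = 0 by omega]
      rfl
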